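/- For $m\ge 1$ and a function $\phi:\mathbb{R}\to\mathbb{R}$, let $\mathcal{S}_m(\phi)$ be the set of all functions $F:\mathbb{R}^m\to\mathbb{R}$ expressed by a shallow $\phi$-network, that is, of the form $$F(x)=\sum_{i=1}^{k}t_i\,\phi(\langle y_i,x\rangle+\varrho_i),\qquad k\in\mathbb{N},\ y_i\in\mathbb{R}^m,\ t_i,\varrho_i\in\mathbb{R}.$$ For a measurable set $\Omega\subset\mathbb{R}^m$, let $L^p(\Omega)$ be the space of real-valued $L^p$ functions on $\Omega$ with respect to Lebesgue measure, with its norm topology, and let $\mathcal{S}_m(\phi)\cap L^p(\Omega)$ be the set of (classes of) those functions in $\mathcal{S}_m(\phi)$ whose restriction to $\Omega$ belongs to $L^p(\Omega)$. **Theorem.** Let $n\in\mathbb{N}$, $2\le p<\infty$ and $\Omega=\mathbb{R}\times[0,1]^n\subset\mathbb{R}^{n+1}$. If a function $\phi:\mathbb{R}\to\mathbb{R}$ satisfies $\overline{\mathcal{S}_1(\phi)\cap L^p(\mathbb{R})}=L^p(\mathbb{R})$, then $\overline{\mathcal{S}_{n+1}(\phi)\cap L^p(\Omega)}=L^p(\Omega)$.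 -/

import Mathlib

open MeasureTheory
open scoped ENNReal

/-- The space `𝒮(φ)` of functions on a Euclidean space `E` (such as `ℝ` or `ℝᵐ`) that are expressed
by a shallow `φ`-network: finite sums `x ↦ ∑ i, t i * φ (⟪y i, x⟫ + ρ i)`, for an arbitrary
activation function `φ : ℝ → ℝ`. -/
def shallowNetworks (E : Type*) [NormedAddCommGroup E] [InnerProductSpace ℝ E] (φ : ℝ → ℝ) :
    Set (E → ℝ) :=
  {F | ∃ (k : ℕ) (y : Fin k → E) (t ρ : Fin k → ℝ),
    F = fun x => ∑ i, t i * φ (inner ℝ (y i) x + ρ i)}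

/-- `𝒮(φ) ∩ Lᵖ(Ω)`: the classes in the real space `Lᵖ(Ω)` (with respect to Lebesgue measure on `Ω`)
of those functions expressed by shallow `φ`-networks whose restriction to `Ω` is
`Lᵖ`-integrable. -/
def shallowNetworksInLp {E : Type*} [NormedAddCommGroup E] [InnerProductSpace ℝ E]
    [MeasureSpace E] (φ : ℝ → ℝ) (p : ℝ≥0∞) (Ω : Set E) :
    Set (Lp ℝ p (volume.restrict Ω : Measure E)) :=
  {f | ∃ F ∈ shallowNetworks E φ, ∃ hF : MemLp F p (volume.restrict Ω), f = hF.toLp F}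

/-- Shallow `φ`-networks are a universal approximator in `Lᵖ(Ω)`: the closure of `𝒮(φ) ∩ Lᵖ(Ω)` in
the normed space `Lᵖ(Ω)` is all of `Lᵖ(Ω)`. -/
def IsUniversalApproximator {E : Type*} [NormedAddCommGroup E] [InnerProductSpace ℝ E]
    [MeasureSpace E] (φ : ℝ → ℝ) (p : ℝ≥0∞) [Fact (1 ≤ p)] (Ω : Set E) : Prop :=
  closure (shallowNetworksInLp φ p Ω) = Set.univ

/-- The strip `ℝ × [0,1]ⁿ` in `ℝⁿ⁺¹`: the coordinate with index `0` is free, the others lie in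
`[0,1]`. -/
def strip (n : ℕ) : Set (EuclideanSpace ℝ (Fin (n + 1))) :=
  {x | ∀ i : Fin n, x i.succ ∈ Set.Icc (0 : ℝ) 1}

/-! Call `x ↦ h ⟪a, x⟫` with `a 0 ≠ 0` a ridge function. On the strip it inherits approximability
from the line, because `⟪a, ·⟫` pushes the measure of the strip to at most a multiple of Lebesgue
measure (`map_inner_strip_le`).

Polynomial factors come from differentiating in the direction `a`: as `e → 0`, the quotient `(z ⟪a +
e e_j, x⟫ - z ⟪a, x⟫) / e` tends to `x_j z' ⟪a, x⟫`, uniformly on the strip since `x_j` is bounded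
there (`isLpLimit_coord_mul_deriv`). The derivatives `z'` with `z` compactly supported have mean
zero, but they are still `Lᵖ`-dense because `1 < p` (`exists_hasDerivAt_eLpNorm_sub_le`).
Multiplication by `x_j` can therefore be iterated, giving every monomial times a ridge function.

Taking `a = e_0` yields polynomials times cutoffs in `x_0`. By Stone–Weierstrass these approximate
compactly supported continuous functions, which are dense in `Lᵖ`. -/

/-- A function of class `Lᵖ` that is a limit in `Lᵖ` of functions from `S`. -/
def IsLpLimit {α : Type*} [MeasurableSpace α] (S : Set (α → ℝ)) (p : ℝ≥0∞) (μ : Measure α)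
    (f : α → ℝ) : Prop :=
  MemLp f p μ ∧ ∀ ε : ℝ≥0∞, ε ≠ 0 → ∃ F ∈ S, MemLp F p μ ∧ eLpNorm (f - F) p μ ≤ ε

/-! ### Closure properties of `Lᵖ` limits -/

namespace IsLpLimit

variable {α : Type*} [MeasurableSpace α] {S : Set (α → ℝ)} {p : ℝ≥0∞} {μ : Measure α}
  {f g : α → ℝ}

theorem of_forall_exists (hp : 1 ≤ p) (hf : MemLp f p μ)
    (h : ∀ ε : ℝ≥0∞, ε ≠ 0 → ∃ g, IsLpLimit S p μ g ∧ eLpNorm (f - g) p μ ≤ ε) :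
    IsLpLimit S p μ f := by
  refine ⟨hf, fun ε hε => ?_⟩
  obtain ⟨g, hg, hfg⟩ := h (ε / 2) (ENNReal.half_pos hε).ne'
  obtain ⟨F, hF, hFp, hgF⟩ := hg.2 (ε / 2) (ENNReal.half_pos hε).ne'
  refine ⟨F, hF, hFp, ?_⟩
  calc eLpNorm (f - F) p μ = eLpNorm ((f - g) + (g - F)) p μ := by rw [sub_add_sub_cancel]
    _ ≤ eLpNorm (f - g) p μ + eLpNorm (g - F) p μ :=
      eLpNorm_add_le (hf.sub hg.1).1 (hg.1.sub hFp).1 hp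
    _ ≤ ε / 2 + ε / 2 := add_le_add hfg hgF
    _ = ε := ENNReal.add_halves ε

theorem add (hp : 1 ≤ p) (hS : ∀ F ∈ S, ∀ G ∈ S, F + G ∈ S) (hf : IsLpLimit S p μ f)
    (hg : IsLpLimit S p μ g) : IsLpLimit S p μ (f + g) := by
  refine ⟨hf.1.add hg.1, fun ε hε => ?_⟩
  obtain ⟨F, hF, hFp, hfF⟩ := hf.2 (ε / 2) (ENNReal.half_pos hε).ne'
  obtain ⟨G, hG, hGp, hgG⟩ := hg.2 (ε / 2) (ENNReal.half_pos hε).ne'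
  refine ⟨F + G, hS F hF G hG, hFp.add hGp, ?_⟩
  calc eLpNorm (f + g - (F + G)) p μ = eLpNorm ((f - F) + (g - G)) p μ := by
        rw [add_sub_add_comm]
    _ ≤ eLpNorm (f - F) p μ + eLpNorm (g - G) p μ :=
      eLpNorm_add_le (hf.1.sub hFp).1 (hg.1.sub hGp).1 hp
    _ ≤ ε / 2 + ε / 2 := add_le_add hfF hgG
    _ = ε := ENNReal.add_halves ε

theorem const_smul (hS : ∀ (c : ℝ), ∀ F ∈ S, c • F ∈ S) (c : ℝ) (hf : IsLpLimit S p μ f) :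
    IsLpLimit S p μ (c • f) := by
  refine ⟨hf.1.const_smul c, fun ε hε => ?_⟩
  have hε' : ε / (‖c‖ₑ + 1) ≠ 0 := by
    simp [ENNReal.div_eq_zero_iff, hε]
  obtain ⟨F, hF, hFp, hfF⟩ := hf.2 _ hε'
  refine ⟨c • F, hS c F hF, hFp.const_smul c, ?_⟩
  rw [← smul_sub, eLpNorm_const_smul]
  calc ‖c‖ₑ * eLpNorm (f - F) p μ ≤ (‖c‖ₑ + 1) * (ε / (‖c‖ₑ + 1)) := by
        gcongr
        exact le_self_add
    _ ≤ ε := ENNReal.mul_div_le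

theorem sum (hp : 1 ≤ p) (hS : ∀ F ∈ S, ∀ G ∈ S, F + G ∈ S) (h0 : 0 ∈ S) {ι : Type*}
    (s : Finset ι) {f : ι → α → ℝ} (hf : ∀ i ∈ s, IsLpLimit S p μ (f i)) :
    IsLpLimit S p μ (∑ i ∈ s, f i) := by
  classical
  induction s using Finset.induction_on with
  | empty => exact ⟨by simp, fun ε _ => ⟨0, h0, by simp, by simp⟩⟩
  | insert i s hi ih =>
    rw [Finset.sum_insert hi]
    exact (hf i (by simp)).add hp hS (ih fun j hj => hf j (by simp [hj]))

end IsLpLimit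

/-! ### Algebra of shallow networks -/

section Networks

variable {E : Type*} [NormedAddCommGroup E] [InnerProductSpace ℝ E] {φ : ℝ → ℝ}

theorem shallowNetworks_zero_mem : (0 : E → ℝ) ∈ shallowNetworks E φ :=
  ⟨0, Fin.elim0, Fin.elim0, Fin.elim0, by ext; simp⟩

theorem shallowNetworks_add_mem {F G : E → ℝ} (hF : F ∈ shallowNetworks E φ)
    (hG : G ∈ shallowNetworks E φ) : F + G ∈ shallowNetworks E φ := by
  obtain ⟨k, y, t, ρ, rfl⟩ := hF
  obtain ⟨l, y', t', ρ', rfl⟩ := hG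
  refine ⟨k + l, Fin.append y y', Fin.append t t', Fin.append ρ ρ', ?_⟩
  ext x
  simp [Fin.sum_univ_add]

theorem shallowNetworks_const_smul_mem (c : ℝ) {F : E → ℝ} (hF : F ∈ shallowNetworks E φ) :
    c • F ∈ shallowNetworks E φ := by
  obtain ⟨k, y, t, ρ, rfl⟩ := hF
  refine ⟨k, y, fun i => c * t i, ρ, ?_⟩
  ext x
  simp [Finset.mul_sum, mul_assoc]

theorem shallowNetworks_comp_inner_mem (a : E) {F : ℝ → ℝ} (hF : F ∈ shallowNetworks ℝ φ) :
    (fun x => F (inner ℝ a x)) ∈ shallowNetworks E φ := by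
  obtain ⟨k, y, t, ρ, rfl⟩ := hF
  refine ⟨k, fun i => y i • a, t, ρ, ?_⟩
  ext x
  simp [real_inner_smul_left, mul_comm]

theorem isUniversalApproximator_iff [MeasureSpace E] (p : ℝ≥0∞) [Fact (1 ≤ p)] (Ω : Set E) :
    IsUniversalApproximator φ p Ω ↔ ∀ f : E → ℝ, MemLp f p (volume.restrict Ω) →
      IsLpLimit (shallowNetworks E φ) p (volume.restrict Ω) f := by
  unfold IsUniversalApproximator
  rw [Set.eq_univ_iff_forall]
  constructor
  · intro h f hf
    refine ⟨hf, fun ε hε => ?_⟩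
    obtain ⟨_, ⟨F, hF, hFp, rfl⟩, hd⟩ :=
      EMetric.mem_closure_iff.1 (h (hf.toLp f)) ε (pos_iff_ne_zero.2 hε)
    rw [Lp.edist_toLp_toLp] at hd
    exact ⟨F, hF, hFp, hd.le⟩
  · intro h f
    refine EMetric.mem_closure_iff.2 fun ε hε => ?_
    obtain ⟨δ, hδ0, hδ⟩ := exists_between hε
    obtain ⟨F, hF, hFp, hd⟩ := (h f (Lp.memLp f)).2 δ hδ0.ne'
    refine ⟨hFp.toLp F, ⟨F, hF, hFp, rfl⟩, ?_⟩
    rw [← Lp.toLp_coeFn f (Lp.memLp f), Lp.edist_toLp_toLp]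
    exact hd.trans_lt hδ

end Networks

/-! ### Projections of the strip to the line -/

section Strip

variable {n : ℕ}

theorem isClosed_strip : IsClosed (strip n) := by
  have : strip n = ⋂ i : Fin n, {x | x i.succ ∈ Set.Icc (0 : ℝ) 1} := by
    ext x; simp [strip]
  rw [this]
  exact isClosed_iInter fun i => isClosed_Icc.preimage (by fun_prop)

/-- The push-forward of Lebesgue measure on the strip under `x ↦ ⟪a, x⟫` is bounded by a multiple of
Lebesgue measure on the line. -/
theorem map_inner_strip_le {a : EuclideanSpace ℝ (Fin (n + 1))} (ha : a 0 ≠ 0) :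
    (volume.restrict (strip n)).map (fun x => inner ℝ a x) ≤
      ENNReal.ofReal |(a 0)⁻¹| • (volume : Measure ℝ) := by
  refine Measure.le_iff.2 fun B hB => ?_
  have hinner : Measurable fun x : EuclideanSpace ℝ (Fin (n + 1)) => inner ℝ a x := by fun_prop
  have hS : MeasurableSet
      ((fun x : EuclideanSpace ℝ (Fin (n + 1)) => inner ℝ a x) ⁻¹' B ∩ strip n) :=
    (hinner hB).inter isClosed_strip.measurableSet
  rw [Measure.map_apply hinner hB, Measure.restrict_apply (hinner hB)]
  -- Split off coordinate `0` to apply Tonelli with the free variable innermost.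
  have he := ((EuclideanSpace.volume_preserving_symm_measurableEquiv_toLp (Fin (n + 1))).symm
    _).comp ((volume_preserving_piFinSuccAbove (fun _ : Fin (n + 1) => ℝ) 0).symm _)
  rw [← he.measure_preimage hS.nullMeasurableSet, Measure.volume_eq_prod,
    Measure.prod_apply_symm (he.measurable hS)]
  -- Over `y` in the cube, the slice lies in an affine preimage of `B` with slope `a 0`; over other
  -- `y` it is empty. The cube has volume one.
  calc _ ≤ ∫⁻ y : Fin n → ℝ, (Set.Icc (0 : Fin n → ℝ) 1).indicator
          (fun _ => ENNReal.ofReal |(a 0)⁻¹| * volume B) y := by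
        refine lintegral_mono fun y => ?_
        by_cases hy : y ∈ Set.Icc (0 : Fin n → ℝ) 1
        · rw [Set.indicator_of_mem hy]
          calc _ ≤ volume ((fun s : ℝ => a 0 * s) ⁻¹'
                ((fun t => t + ∑ i : Fin n, a i.succ * y i) ⁻¹' B)) := by
                refine measure_mono fun s hs => ?_
                have h1 := hs.1
                simpa [PiLp.inner_apply, Fin.sum_univ_succ, mul_comm] using h1
            _ = _ := by
                rw [Real.volume_preimage_mul_left ha, measure_preimage_add_right]
        · rw [Set.indicator_of_notMem hy]
          refine le_of_eq ?_
          convert measure_empty (μ := (volume : Measure ℝ))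
          rw [Set.eq_empty_iff_forall_notMem]
          intro s hs
          refine hy ⟨fun i => ?_, fun i => ?_⟩
          · simpa using (hs.2 i).1
          · simpa using (hs.2 i).2
    _ = _ := by
        rw [lintegral_indicator measurableSet_Icc]
        simp [Real.volume_Icc_pi]

end Strip

theorem ENNReal.exists_pos_mul_ofReal_le {A ε : ℝ≥0∞} (hA : A ≠ ∞) (hε : ε ≠ 0) :
    ∃ η : ℝ, 0 < η ∧ A * ENNReal.ofReal η ≤ ε := by
  -- The minimum with `1` keeps `η` finite when `ε = ∞`.
  have h0 : min 1 (ε / (A + 1)) ≠ 0 := by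
    simp [min_eq_iff, ENNReal.div_eq_zero_iff, hε, hA]
  have hT : min 1 (ε / (A + 1)) ≠ ∞ := (min_le_left _ _).trans_lt ENNReal.one_lt_top |>.ne
  refine ⟨(min 1 (ε / (A + 1))).toReal, ENNReal.toReal_pos h0 hT, ?_⟩
  rw [ENNReal.ofReal_toReal hT]
  calc A * min 1 (ε / (A + 1)) ≤ (A + 1) * (ε / (A + 1)) := by
        gcongr
        · exact le_self_add
        · exact min_le_right _ _
    _ ≤ ε := ENNReal.mul_div_le

/-! ### Dilations and derivatives on the line -/

section Line

theorem HasCompactSupport.exists_eq_zero_of_le_abs {h : ℝ → ℝ} (hs : HasCompactSupport h) :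
    ∃ R : ℝ, 0 < R ∧ ∀ t, R ≤ |t| → h t = 0 := by
  obtain ⟨R, hR⟩ := hs.isCompact.isBounded.subset_ball 0
  refine ⟨max R 1, by positivity, fun t ht => ?_⟩
  by_contra hne
  have := hR (subset_tsupport _ hne)
  rw [mem_ball_zero_iff, Real.norm_eq_abs] at this
  exact absurd ((le_max_left R 1).trans ht) (not_le.2 this)

theorem hasCompactSupport_of_eq_zero_of_lt_abs {h : ℝ → ℝ} {R : ℝ} (hR : ∀ t, R < |t| → h t = 0) :
    HasCompactSupport h := by
  refine HasCompactSupport.intro (isCompact_Icc (a := -R) (b := R)) fun t ht => hR t ?_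
  by_contra! hle
  exact ht (abs_le.1 hle)

/-- Dilations that preserve the integral make the `Lᵖ` norm arbitrarily small when `1 < p`. -/
theorem exists_dilation_eLpNorm_le {p : ℝ≥0∞} (hp : 1 < p) (hp' : p ≠ ∞) {h : ℝ → ℝ}
    (hc : Continuous h) (hs : HasCompactSupport h) {ε : ℝ≥0∞} (hε : ε ≠ 0) :
    ∃ N : ℝ, 1 ≤ N ∧ eLpNorm (fun t => N⁻¹ * h (t / N)) p volume ≤ ε := by
  obtain ⟨R, hR, hzero⟩ := hs.exists_eq_zero_of_le_abs
  obtain ⟨M, hM⟩ := hc.bounded_above_of_compact_support hs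
  have hM0 : 0 ≤ M := (norm_nonneg _).trans (hM 0)
  have hp1 : 1 < p.toReal := by
    simpa using (ENNReal.toReal_lt_toReal ENNReal.one_ne_top hp').2 hp
  have hq : 0 < 1 - 1 / p.toReal := by
    rw [sub_pos, div_lt_one (by linarith)]
    exact hp1
  -- If `h` is supported in `[-R, R]` and bounded by `M`, the dilate has norm at most `N⁻¹ M (2 R N)
  -- ^ (1 / p)`, a negative power of `N` as `1 < p`.
  have hlim : Filter.Tendsto
      (fun N : ℝ => ENNReal.ofReal (M * (2 * R) ^ (1 / p.toReal) * N ^ (-(1 - 1 / p.toReal))))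
      Filter.atTop (nhds 0) := by
    have := (tendsto_rpow_neg_atTop hq).const_mul (M * (2 * R) ^ (1 / p.toReal))
    simpa using ENNReal.tendsto_ofReal this
  obtain ⟨N, hN, hN1⟩ := ((hlim.eventually (ge_mem_nhds (pos_iff_ne_zero.2 hε))).and
    (Filter.eventually_ge_atTop 1)).exists
  refine ⟨N, hN1, le_trans ?_ hN⟩
  have hN0 : 0 < N := by linarith
  calc eLpNorm (fun t => N⁻¹ * h (t / N)) p volume
      ≤ eLpNorm ((Set.Icc (-(R * N)) (R * N)).indicator fun _ => N⁻¹ * M) p volume := by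
        refine eLpNorm_mono fun t => ?_
        by_cases ht : t ∈ Set.Icc (-(R * N)) (R * N)
        · rw [Set.indicator_of_mem ht, norm_mul, norm_mul]
          gcongr
          exact (hM _).trans (le_abs_self M)
        · rw [hzero, mul_zero, norm_zero]
          · positivity
          · rw [abs_div, abs_of_pos hN0, le_div_iff₀ hN0]
            by_contra! hlt
            exact ht (abs_le.1 hlt.le)
    _ = ENNReal.ofReal (N⁻¹ * M) * ENNReal.ofReal (2 * R * N) ^ (1 / p.toReal) := by
        rw [eLpNorm_indicator_const measurableSet_Icc (by positivity) hp', Real.volume_Icc,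
          Real.enorm_of_nonneg (by positivity)]
        ring_nf
    _ = _ := by
        rw [ENNReal.ofReal_rpow_of_nonneg (by positivity) (by positivity),
          ← ENNReal.ofReal_mul (by positivity), Real.mul_rpow (by positivity) hN0.le,
          neg_sub, Real.rpow_sub_one hN0.ne']
        congr 1
        field_simp

/-- Derivatives of compactly supported `C¹` functions are dense, for the `Lᵖ` norm with `1 < p`, in
the compactly supported continuous functions. -/
theorem exists_hasDerivAt_eLpNorm_sub_le {p : ℝ≥0∞} (hp : 1 < p) (hp' : p ≠ ∞) {h : ℝ → ℝ}
    (hc : Continuous h) (hs : HasCompactSupport h) {ε : ℝ≥0∞} (hε : ε ≠ 0) :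
    ∃ z w : ℝ → ℝ, (∀ t, HasDerivAt z (w t) t) ∧ HasCompactSupport z ∧ Continuous w ∧
      HasCompactSupport w ∧ eLpNorm (h - w) p volume ≤ ε := by
  obtain ⟨N, hN1, hN⟩ := exists_dilation_eLpNorm_le hp hp' hc hs hε
  have hN0 : 0 < N := by linarith
  obtain ⟨R, hR, hzero⟩ := hs.exists_eq_zero_of_le_abs
  -- Subtracting a dilate with the same integral and small norm makes the mean zero, so the
  -- primitive of `w` vanishes on both sides of its support.
  set w : ℝ → ℝ := fun t => h t - N⁻¹ * h (t / N) with hw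
  have hwc : Continuous w := by fun_prop
  have hw0 : ∀ t, R * N ≤ |t| → w t = 0 := by
    intro t ht
    have h1 : R ≤ |t| := by nlinarith
    have h2 : R ≤ |t / N| := by rwa [abs_div, abs_of_pos hN0, le_div_iff₀ hN0]
    simp [hw, hzero _ h1, hzero _ h2]
  have hws : HasCompactSupport w := hasCompactSupport_of_eq_zero_of_lt_abs fun t ht => hw0 t ht.le
  have hint : ∫ t, w t = 0 := by
    have hi : Integrable h := hc.integrable_of_hasCompactSupport hs
    rw [hw, integral_sub hi ((hi.comp_div hN0.ne').const_mul _), integral_const_mul,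
      Measure.integral_comp_div, abs_of_pos hN0, smul_eq_mul, inv_mul_cancel_left₀ hN0.ne',
      sub_self]
  refine ⟨fun t => ∫ s in (-(R * N))..t, w s, w,
    fun t => (hwc.integral_hasStrictDerivAt _ _).hasDerivAt,
    hasCompactSupport_of_eq_zero_of_lt_abs (R := R * N) fun t ht => ?_, hwc, hws, ?_⟩
  · rcases lt_abs.1 ht with ht | ht
    · rw [intervalIntegral.integral_eq_integral_of_support_subset, hint]
      intro s hsw
      have : |s| < R * N := by
        by_contra! hle
        exact hsw (hw0 s hle)
      rw [abs_lt] at this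
      exact ⟨this.1, (this.2.trans ht).le⟩
    · rw [intervalIntegral.integral_symm, neg_eq_zero]
      refine intervalIntegral.integral_zero_ae (Filter.Eventually.of_forall fun s hst => ?_)
      rw [Set.uIoc_of_le (by linarith)] at hst
      exact hw0 s (le_abs.2 (Or.inr (by linarith [hst.2])))
  · convert hN using 2
    ext t
    simp [hw]

/-- First-order expansion, uniform in the base point. -/
theorem exists_abs_sub_sub_mul_le {z w : ℝ → ℝ} (hz : ∀ t, HasDerivAt z (w t) t)
    (hw : UniformContinuous w) {η : ℝ} (hη : 0 < η) :
    ∃ δ > 0, ∀ t u, |u| < δ → |z (t + u) - z t - u * w t| ≤ η * |u| := by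
  obtain ⟨δ, hδ, hδw⟩ := Metric.uniformContinuous_iff.1 hw η hη
  refine ⟨δ, hδ, fun t u hu => ?_⟩
  -- Mean value inequality for `r ↦ z (t + r) - r * w t`; uniform continuity makes `δ` independent
  -- of `t`.
  have hderiv : ∀ r ∈ Metric.ball (0 : ℝ) δ, HasDerivWithinAt (fun r => z (t + r) - r * w t)
      (w (t + r) - w t) (Metric.ball 0 δ) r := by
    intro r _
    have h1 : HasDerivAt (fun r => z (t + r)) (w (t + r)) r := (hz (t + r)).comp_const_add t r
    have h2 : HasDerivAt (fun r => r * w t) (w t) r := by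
      simpa using (hasDerivAt_id r).mul_const (w t)
    exact (h1.sub h2).hasDerivWithinAt
  have hbound : ∀ r ∈ Metric.ball (0 : ℝ) δ, ‖w (t + r) - w t‖ ≤ η := by
    intro r hr
    have : dist (t + r) t < δ := by simpa using hr
    simpa [Real.dist_eq] using (hδw this).le
  have := Convex.norm_image_sub_le_of_norm_hasDerivWithin_le hderiv hbound (convex_ball 0 δ)
    (Metric.mem_ball_self hδ) (y := u) (by simpa using hu)
  simp only [Real.norm_eq_abs, add_zero, zero_mul, sub_zero] at this
  rwa [show z (t + u) - z t - u * w t = z (t + u) - u * w t - z t by ring]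

end Line

/-! ### Transfer of estimates from the line to the strip -/

section Strip

variable {n : ℕ} {p : ℝ≥0∞} {φ : ℝ → ℝ} {a : EuclideanSpace ℝ (Fin (n + 1))}

theorem exists_eLpNorm_strip_le (ha : a 0 ≠ 0) (hp' : p ≠ ∞) :
    ∃ K : ℝ≥0∞, K ≠ ∞ ∧ ∀ (f : EuclideanSpace ℝ (Fin (n + 1)) → ℝ) (G : ℝ → ℝ),
      AEStronglyMeasurable G volume → (∀ x ∈ strip n, |f x| ≤ |G (inner ℝ a x)|) →
      eLpNorm f p (volume.restrict (strip n)) ≤ K * eLpNorm G p volume := by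
  refine ⟨ENNReal.ofReal |(a 0)⁻¹| ^ (1 / p).toReal,
    ENNReal.rpow_ne_top_of_nonneg ENNReal.toReal_nonneg ENNReal.ofReal_ne_top,
    fun f G hG hfG => ?_⟩
  have hG' : AEStronglyMeasurable G ((volume.restrict (strip n)).map fun x => inner ℝ a x) :=
    (hG.smul_measure _).mono_measure (map_inner_strip_le ha)
  calc eLpNorm f p (volume.restrict (strip n))
      ≤ eLpNorm (G ∘ fun x => inner ℝ a x) p (volume.restrict (strip n)) :=
        eLpNorm_mono_ae (ae_restrict_of_forall_mem isClosed_strip.measurableSet hfG)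
    _ = eLpNorm G p ((volume.restrict (strip n)).map fun x => inner ℝ a x) :=
        (eLpNorm_map_measure hG' (by fun_prop)).symm
    _ ≤ eLpNorm G p (ENNReal.ofReal |(a 0)⁻¹| • volume) :=
        eLpNorm_mono_measure _ (map_inner_strip_le ha)
    _ = _ := by rw [eLpNorm_smul_measure_of_ne_top hp', smul_eq_mul]

theorem memLp_strip_of_le (ha : a 0 ≠ 0) (hp' : p ≠ ∞)
    {f : EuclideanSpace ℝ (Fin (n + 1)) → ℝ} (hf : Continuous f) {G : ℝ → ℝ}
    (hG : MemLp G p volume) (hfG : ∀ x ∈ strip n, |f x| ≤ |G (inner ℝ a x)|) :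
    MemLp f p (volume.restrict (strip n)) := by
  obtain ⟨K, hK, h⟩ := exists_eLpNorm_strip_le ha hp'
  exact ⟨hf.aestronglyMeasurable, (h f G hG.1 hfG).trans_lt (ENNReal.mul_lt_top hK.lt_top hG.2)⟩

/-- The slab `|⟪a, x⟫| ≤ R` meets the strip in finite measure, so uniform smallness there gives `Lᵖ`
smallness. -/
theorem exists_pos_eLpNorm_strip_le_of_abs_le (ha : a 0 ≠ 0) (hp0 : p ≠ 0) (hp' : p ≠ ∞) (R : ℝ)
    {ε : ℝ≥0∞} (hε : ε ≠ 0) :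
    ∃ η : ℝ, 0 < η ∧ ∀ f : EuclideanSpace ℝ (Fin (n + 1)) → ℝ, (∀ x ∈ strip n, |f x| ≤ η) →
      (∀ x ∈ strip n, R < |inner ℝ a x| → f x = 0) →
      eLpNorm f p (volume.restrict (strip n)) ≤ ε := by
  obtain ⟨K, hK, h⟩ := exists_eLpNorm_strip_le ha hp'
  have hV : (volume (Set.Icc (-R) R)) ^ (1 / p.toReal) ≠ ∞ :=
    ENNReal.rpow_ne_top_of_nonneg (by positivity) isCompact_Icc.measure_lt_top.ne
  obtain ⟨η, hη, hηε⟩ := ENNReal.exists_pos_mul_ofReal_le (ENNReal.mul_ne_top hK hV) hε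
  refine ⟨η, hη, fun f hf hf0 => ?_⟩
  refine (h f ((Set.Icc (-R) R).indicator fun _ => η)
    (aestronglyMeasurable_const.indicator measurableSet_Icc) fun x hx => ?_).trans ?_
  · by_cases ht : inner ℝ a x ∈ Set.Icc (-R) R
    · rw [Set.indicator_of_mem ht, abs_of_pos hη]
      exact hf x hx
    · rw [hf0 x hx (by by_contra! hle; exact ht (abs_le.1 hle)), abs_zero]
      exact abs_nonneg _
  · rw [eLpNorm_indicator_const measurableSet_Icc hp0 hp', Real.enorm_of_nonneg hη.le]
    exact le_of_eq_of_le (by ring) hηε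

theorem isLpLimit_comp_inner (ha : a 0 ≠ 0) (hp' : p ≠ ∞) {h : ℝ → ℝ}
    (hc : Continuous h) (hh : IsLpLimit (shallowNetworks ℝ φ) p volume h) :
    IsLpLimit (shallowNetworks (EuclideanSpace ℝ (Fin (n + 1))) φ) p (volume.restrict (strip n))
      fun x => h (inner ℝ a x) := by
  have hmem := memLp_strip_of_le ha hp' (f := fun x => h (inner ℝ a x)) (by fun_prop) hh.1
    fun _ _ => le_rfl
  refine ⟨hmem, fun ε hε => ?_⟩
  obtain ⟨K, hK, hle⟩ := exists_eLpNorm_strip_le ha hp'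
  obtain ⟨η, hη, hηε⟩ := ENNReal.exists_pos_mul_ofReal_le hK hε
  obtain ⟨F, hF, hFp, hFh⟩ := hh.2 (ENNReal.ofReal η) (by simpa using hη)
  refine ⟨_, shallowNetworks_comp_inner_mem a hF, ?_, ?_⟩
  · exact ((hFp.of_measure_le_smul ENNReal.ofReal_ne_top (map_inner_strip_le ha))).comp_of_map
      (by fun_prop)
  · refine le_trans (hle _ (h - F) (hh.1.sub hFp).1 fun x _ => le_rfl) (le_trans ?_ hηε)
    gcongr

end Strip

/-! ### Polynomial multiples of ridge functions -/

/-- Continuous functions, bounded on the strip, whose products with compactly supported ridge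
functions in non-degenerate directions are `Lᵖ` limits of shallow networks. -/
structure IsRidgeMultiplier (φ : ℝ → ℝ) (p : ℝ≥0∞) {n : ℕ}
    (v : EuclideanSpace ℝ (Fin (n + 1)) → ℝ) : Prop where
  continuous : Continuous v
  bounded : ∃ C, ∀ x ∈ strip n, |v x| ≤ C
  isLpLimit : ∀ a : EuclideanSpace ℝ (Fin (n + 1)), a 0 ≠ 0 → ∀ h : ℝ → ℝ, Continuous h →
    HasCompactSupport h → IsLpLimit (shallowNetworks (EuclideanSpace ℝ (Fin (n + 1))) φ) p
      (volume.restrict (strip n)) fun x => v x * h (inner ℝ a x)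

section Strip

variable {n : ℕ} {p : ℝ≥0∞} {φ : ℝ → ℝ} {v : EuclideanSpace ℝ (Fin (n + 1)) → ℝ}

theorem abs_coord_succ_le_one {x : EuclideanSpace ℝ (Fin (n + 1))} (hx : x ∈ strip n)
    (j : Fin n) : |x j.succ| ≤ 1 :=
  abs_le.2 ⟨by linarith [(hx j).1], (hx j).2⟩

theorem isRidgeMultiplier_one (hp' : p ≠ ∞)
    (hφ : ∀ h : ℝ → ℝ, MemLp h p volume → IsLpLimit (shallowNetworks ℝ φ) p volume h) :
    IsRidgeMultiplier φ p (fun _ : EuclideanSpace ℝ (Fin (n + 1)) => 1) where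
  continuous := continuous_const
  bounded := ⟨1, by simp⟩
  isLpLimit a ha h hc hs := by
    simpa using isLpLimit_comp_inner ha hp' hc (hφ h (hc.memLp_of_hasCompactSupport hs))

namespace IsRidgeMultiplier

/-- Differentiating a ridge function with respect to its direction. -/
theorem isLpLimit_coord_mul_deriv (hp : 1 ≤ p) (hp' : p ≠ ∞) (hv : IsRidgeMultiplier φ p v)
    (j : Fin n) {a : EuclideanSpace ℝ (Fin (n + 1))} (ha : a 0 ≠ 0) {z w : ℝ → ℝ}
    (hz : ∀ t, HasDerivAt z (w t) t) (hzs : HasCompactSupport z) (hw : Continuous w)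
    (hws : HasCompactSupport w) :
    IsLpLimit (shallowNetworks (EuclideanSpace ℝ (Fin (n + 1))) φ) p (volume.restrict (strip n))
      fun x => x j.succ * v x * w (inner ℝ a x) := by
  obtain ⟨C, hC⟩ := hv.bounded
  have hvc := hv.continuous
  have hzc : Continuous z := continuous_iff_continuousAt.2 fun t => (hz t).continuousAt
  have hvC : ∀ x ∈ strip n, |v x| ≤ |C| := fun x hx => (hC x hx).trans (le_abs_self C)
  refine IsLpLimit.of_forall_exists hp (memLp_strip_of_le ha hp' (by fun_prop)
    ((hw.memLp_of_hasCompactSupport hws).const_mul C) fun x hx => ?_) fun ε hε => ?_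
  · rw [abs_mul, abs_mul, abs_mul]
    gcongr
    calc |x j.succ| * |v x| ≤ 1 * |C| :=
          mul_le_mul (abs_coord_succ_le_one hx j) (hvC x hx) (abs_nonneg _) zero_le_one
      _ = |C| := one_mul _
  obtain ⟨R₁, -, hR₁⟩ := hzs.exists_eq_zero_of_le_abs
  obtain ⟨R₂, -, hR₂⟩ := hws.exists_eq_zero_of_le_abs
  -- The `+ 1` allows for `⟪b, x⟫` differing from `⟪a, x⟫` by at most `e < 1` on the strip.
  obtain ⟨η, hη, hηε⟩ := exists_pos_eLpNorm_strip_le_of_abs_le ha (by positivity) hp'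
    (max R₁ R₂ + 1) hε
  obtain ⟨δ, hδ, hδz⟩ := exists_abs_sub_sub_mul_le hz (hws.uniformContinuous_of_continuous hw)
    (η := η / (|C| + 1)) (by positivity)
  obtain ⟨e, he0, he⟩ := exists_between (lt_min hδ one_pos)
  obtain ⟨heδ, he1⟩ := lt_min_iff.1 he
  set b : EuclideanSpace ℝ (Fin (n + 1)) := a + e • EuclideanSpace.single j.succ 1 with hb
  have hb0 : b 0 ≠ 0 := by simpa [hb, (Fin.succ_ne_zero j).symm] using ha
  have hbx : ∀ x, inner ℝ b x = inner ℝ a x + e * x j.succ := by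
    intro x
    simp [hb, inner_add_left, real_inner_smul_left, EuclideanSpace.inner_single_left]
  have hexj : ∀ x ∈ strip n, |e * x j.succ| ≤ e := by
    intro x hx
    rw [abs_mul, abs_of_pos he0]
    exact mul_le_of_le_one_right he0.le (abs_coord_succ_le_one hx j)
  -- The approximant is the difference quotient `e⁻¹ * v x * (z ⟪b, x⟫ - z ⟪a, x⟫)`.
  refine ⟨_, ((hv.isLpLimit b hb0 z hzc hzs).const_smul
    (fun c _ => shallowNetworks_const_smul_mem c) e⁻¹).add hp
    (fun _ hF _ => shallowNetworks_add_mem hF) ((hv.isLpLimit a ha z hzc hzs).const_smul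
    (fun c _ => shallowNetworks_const_smul_mem c) (-e⁻¹)), hηε _ (fun x hx => ?_)
    fun x hx hxR => ?_⟩
  · have h1 := hδz (inner ℝ a x) (e * x j.succ) ((hexj x hx).trans_lt heδ)
    have h2 : x j.succ * v x * w (inner ℝ a x) -
        (e⁻¹ * (v x * z (inner ℝ b x)) + -e⁻¹ * (v x * z (inner ℝ a x))) =
        -(v x * e⁻¹ * (z (inner ℝ a x + e * x j.succ) - z (inner ℝ a x) -
          e * x j.succ * w (inner ℝ a x))) := by
      rw [hbx]
      field_simp
      ring
    simp only [Pi.sub_apply, Pi.add_apply, Pi.smul_apply, smul_eq_mul]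
    rw [h2, abs_neg, abs_mul, abs_mul, abs_of_pos (inv_pos.2 he0)]
    calc |v x| * e⁻¹ * |z (inner ℝ a x + e * x j.succ) - z (inner ℝ a x) -
          e * x j.succ * w (inner ℝ a x)|
        ≤ (|C| + 1) * e⁻¹ * (η / (|C| + 1) * e) := by
          gcongr
          · exact (hvC x hx).trans (by linarith)
          · exact h1.trans (by gcongr; exact hexj x hx)
      _ = η := by
          have : |C| + 1 ≠ 0 := by positivity
          field_simp
  · have h1 : R₁ ≤ |inner ℝ a x| := by linarith [le_max_left R₁ R₂]
    have h2 : R₂ ≤ |inner ℝ a x| := by linarith [le_max_right R₁ R₂]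
    have h3 : R₁ ≤ |inner ℝ b x| := by
      have h4 : |inner ℝ a x| ≤ |inner ℝ b x| + |e * x j.succ| := by
        rw [hbx]
        simpa using abs_sub (inner ℝ a x + e * x j.succ) (e * x j.succ)
      linarith [le_max_left R₁ R₂, hexj x hx]
    simp [hR₁ _ h1, hR₁ _ h3, hR₂ _ h2]

/-- The previous lemma handles derivatives; a general `h` is `Lᵖ`-close to one, and the bounded
factor `x_j v` preserves closeness. -/
theorem coord_mul (hp : 1 < p) (hp' : p ≠ ∞) (hv : IsRidgeMultiplier φ p v) (j : Fin n) :
    IsRidgeMultiplier φ p fun x => x j.succ * v x := by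
  have hvc := hv.continuous
  have hbd : ∃ C, ∀ x ∈ strip n, |x j.succ * v x| ≤ C := by
    obtain ⟨C, hC⟩ := hv.bounded
    refine ⟨C, fun x hx => ?_⟩
    rw [abs_mul]
    exact (mul_le_of_le_one_left (abs_nonneg _) (abs_coord_succ_le_one hx j)).trans (hC x hx)
  refine ⟨by fun_prop, hbd, fun a ha h hc hs => ?_⟩
  obtain ⟨C, hC⟩ := hbd
  have hle : ∀ (G : ℝ → ℝ), ∀ x ∈ strip n,
      |x j.succ * v x * G (inner ℝ a x)| ≤ |C * G (inner ℝ a x)| := by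
    intro G x hx
    rw [abs_mul, abs_mul C]
    exact mul_le_mul_of_nonneg_right ((hC x hx).trans (le_abs_self C)) (abs_nonneg _)
  refine IsLpLimit.of_forall_exists hp.le (memLp_strip_of_le ha hp' (by fun_prop)
    ((hc.memLp_of_hasCompactSupport hs).const_mul C) (hle h)) fun ε hε => ?_
  obtain ⟨K, hK, hKle⟩ := exists_eLpNorm_strip_le (n := n) ha hp'
  obtain ⟨η, hη, hηε⟩ := ENNReal.exists_pos_mul_ofReal_le
    (ENNReal.mul_ne_top hK (enorm_ne_top (x := C))) hε
  obtain ⟨z, w, hz, hzs, hw, hws, hhw⟩ := exists_hasDerivAt_eLpNorm_sub_le hp hp' hc hs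
    (ε := ENNReal.ofReal η) (by simpa using hη)
  refine ⟨_, hv.isLpLimit_coord_mul_deriv hp.le hp' j ha hz hzs hw hws, ?_⟩
  refine (hKle _ (C • (h - w)) ((hc.sub hw).const_smul C).aestronglyMeasurable
    fun x hx => ?_).trans ?_
  · simpa [mul_sub] using hle (h - w) x hx
  · rw [eLpNorm_const_smul, ← mul_assoc]
    exact le_trans (by gcongr) hηε

theorem coord_pow_mul (hp : 1 < p) (hp' : p ≠ ∞) (hv : IsRidgeMultiplier φ p v) (j : Fin n)
    (k : ℕ) : IsRidgeMultiplier φ p fun x => x j.succ ^ k * v x := by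
  induction k with
  | zero => simpa using hv
  | succ k ih => simpa only [pow_succ', mul_assoc] using ih.coord_mul hp hp' j

end IsRidgeMultiplier

theorem isRidgeMultiplier_monomial (hp : 1 < p) (hp' : p ≠ ∞)
    (hφ : ∀ h : ℝ → ℝ, MemLp h p volume → IsLpLimit (shallowNetworks ℝ φ) p volume h)
    (k : Fin n → ℕ) :
    IsRidgeMultiplier φ p
      fun x : EuclideanSpace ℝ (Fin (n + 1)) => ∏ j, x j.succ ^ k j := by
  induction (Finset.univ : Finset (Fin n)) using Finset.induction_on with
  | empty => simpa using isRidgeMultiplier_one hp' hφ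
  | insert j s hj ih => simpa only [Finset.prod_insert hj] using ih.coord_pow_mul hp hp' j (k j)

theorem isLpLimit_polynomial_mul (hp : 1 < p) (hp' : p ≠ ∞)
    (hφ : ∀ h : ℝ → ℝ, MemLp h p volume → IsLpLimit (shallowNetworks ℝ φ) p volume h)
    (q : MvPolynomial (Fin (n + 1)) ℝ) {h : ℝ → ℝ} (hc : Continuous h)
    (hs : HasCompactSupport h) :
    IsLpLimit (shallowNetworks (EuclideanSpace ℝ (Fin (n + 1))) φ) p (volume.restrict (strip n))
      fun x => MvPolynomial.eval x.ofLp q * h (x 0) := by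
  have hsum : (fun x : EuclideanSpace ℝ (Fin (n + 1)) => MvPolynomial.eval x.ofLp q * h (x 0)) =
      ∑ d ∈ q.support, q.coeff d • fun x : EuclideanSpace ℝ (Fin (n + 1)) =>
        (∏ j : Fin n, x j.succ ^ d j.succ) * (x 0 ^ d 0 * h (x 0)) := by
    ext x
    simp only [MvPolynomial.eval_eq', Finset.sum_mul, Finset.sum_apply, Pi.smul_apply, smul_eq_mul,
      Fin.prod_univ_succ]
    exact Finset.sum_congr rfl fun d _ => by ring
  rw [hsum]
  refine IsLpLimit.sum hp.le (fun _ hF _ => shallowNetworks_add_mem hF) shallowNetworks_zero_mem _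
    fun d _ => IsLpLimit.const_smul (fun c _ => shallowNetworks_const_smul_mem c) _ ?_
  -- With `a = e_0`, powers of the unbounded coordinate are absorbed into the compactly supported
  -- profile.
  simpa [EuclideanSpace.inner_single_left] using (isRidgeMultiplier_monomial hp hp' hφ fun j : Fin n => d j.succ).isLpLimit
    (EuclideanSpace.single 0 1) (by simp) (fun t => t ^ d 0 * h t) (by fun_prop) hs.mul_left

end Strip

/-! ### Stone–Weierstrass and density -/

/-- Polynomials are dense in the continuous functions on a compact subset of `ℝᵐ`. -/
theorem exists_mvPolynomial_abs_eval_sub_lt {m : ℕ} {K : Set (EuclideanSpace ℝ (Fin m))}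
    (hK : IsCompact K) {g : EuclideanSpace ℝ (Fin m) → ℝ} (hg : Continuous g) {η : ℝ}
    (hη : 0 < η) : ∃ q : MvPolynomial (Fin m) ℝ, ∀ x ∈ K, |g x - MvPolynomial.eval x.ofLp q| < η := by
  have := isCompact_iff_compactSpace.1 hK
  let coord : Fin m → C(K, ℝ) := fun i => ⟨fun x => x.1 i, by fun_prop⟩
  have hsep : (MvPolynomial.aeval (R := ℝ) coord).range.SeparatesPoints := by
    intro x y hxy
    obtain ⟨i, hi⟩ : ∃ i, x.1 i ≠ y.1 i := by
      by_contra! hall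
      exact hxy (Subtype.ext (by ext i; exact hall i))
    exact ⟨_, ⟨coord i, ⟨MvPolynomial.X i, by simp⟩, rfl⟩, hi⟩
  have hmem : (⟨fun x => g x.1, by fun_prop⟩ : C(K, ℝ)) ∈
      (MvPolynomial.aeval (R := ℝ) coord).range.topologicalClosure := by
    rw [ContinuousMap.subalgebra_topologicalClosure_eq_top_of_separatesPoints _ hsep]
    trivial
  obtain ⟨_, ⟨q, rfl⟩, hq⟩ := Metric.mem_closure_iff.1 hmem η hη
  refine ⟨q, fun x hx => ?_⟩
  have heval : (MvPolynomial.aeval (R := ℝ) coord q) ⟨x, hx⟩ = MvPolynomial.eval x.ofLp q := by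
    clear hq
    induction q using MvPolynomial.induction_on with
    | C c => simp
    | add q₁ q₂ h₁ h₂ => simp [h₁, h₂]
    | mul_X q i h => simp [h, coord]
  have h := (ContinuousMap.dist_apply_le_dist (⟨x, hx⟩ : K)).trans_lt hq
  rw [Real.dist_eq] at h
  rw [← heval]
  exact h

theorem isLpLimit_of_hasCompactSupport {n : ℕ} {p : ℝ≥0∞} {φ : ℝ → ℝ} (hp : 1 < p) (hp' : p ≠ ∞)
    (hφ : ∀ h : ℝ → ℝ, MemLp h p volume → IsLpLimit (shallowNetworks ℝ φ) p volume h)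
    {g : EuclideanSpace ℝ (Fin (n + 1)) → ℝ} (hg : Continuous g) (hgs : HasCompactSupport g) :
    IsLpLimit (shallowNetworks (EuclideanSpace ℝ (Fin (n + 1))) φ) p (volume.restrict (strip n))
      g := by
  refine IsLpLimit.of_forall_exists hp.le (hg.memLp_of_hasCompactSupport hgs) fun ε hε => ?_
  obtain ⟨R, hR⟩ := hgs.isCompact.isBounded.subset_closedBall 0
  have hgR : ∀ x, R < |x 0| → g x = 0 := by
    intro x hx
    by_contra hne
    have h1 := hR (subset_tsupport _ hne)
    rw [mem_closedBall_zero_iff] at h1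
    exact absurd ((PiLp.norm_apply_le x 0).trans h1) (not_le.2 hx)
  obtain ⟨η, hη, hηε⟩ := exists_pos_eLpNorm_strip_le_of_abs_le (n := n)
    (a := EuclideanSpace.single 0 1) (by simp) (by positivity) hp' (R + 1) hε
  -- This box contains the part of the strip with `|x 0| ≤ R + 1`, the other coordinates being at
  -- most `1`.
  have hK : IsCompact ((WithLp.toLp 2) '' Set.Icc (fun _ => -max (R + 1) 1)
      (fun _ => max (R + 1) 1) : Set (EuclideanSpace ℝ (Fin (n + 1)))) :=
    isCompact_Icc.image (PiLp.continuous_toLp 2 _)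
  obtain ⟨q, hq⟩ := exists_mvPolynomial_abs_eval_sub_lt hK hg hη
  -- Since `χ = 1` on `[-R, R]`, `g = g χ`, so the error is `(g - q) χ`, which vanishes where `q` is
  -- not controlled.
  set χ : ℝ → ℝ := fun t => max 0 (min 1 (R + 1 - |t|)) with hχ
  have hχc : Continuous χ := by fun_prop
  have hχ0 : ∀ t, R + 1 < |t| → χ t = 0 := fun t ht =>
    max_eq_left ((min_le_right _ _).trans (by linarith))
  have hχ1 : ∀ t, |t| ≤ R → χ t = 1 := by
    intro t ht
    rw [hχ]
    simp only
    rw [min_eq_left (by linarith), max_eq_right zero_le_one]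
  have hχabs : ∀ t, |χ t| ≤ 1 := fun t => by
    rw [abs_of_nonneg (le_max_left _ _)]
    exact max_le zero_le_one (min_le_left _ _)
  have hgχ : ∀ x, g x = g x * χ (x 0) := by
    intro x
    rcases le_or_gt |x 0| R with hx | hx
    · rw [hχ1 _ hx, mul_one]
    · rw [hgR _ hx, zero_mul]
  refine ⟨_, isLpLimit_polynomial_mul hp hp' hφ q hχc (hasCompactSupport_of_eq_zero_of_lt_abs hχ0),
    hηε _ (fun x hx => ?_) fun x hx hxR => ?_⟩
  · rw [Pi.sub_apply, hgχ, ← sub_mul, abs_mul]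
    rcases le_or_gt |x 0| (R + 1) with hx0 | hx0
    · have hxK : ∀ i, |x i| ≤ max (R + 1) 1 := by
        refine Fin.cases (hx0.trans (le_max_left _ _)) fun j => ?_
        exact (abs_coord_succ_le_one hx j).trans (le_max_right _ _)
      have h1 := hq x ⟨x.ofLp, ⟨fun i => (abs_le.1 (hxK i)).1, fun i => (abs_le.1 (hxK i)).2⟩, rfl⟩
      exact (mul_le_of_le_one_right (abs_nonneg _) (hχabs _)).trans h1.le
    · rw [hχ0 _ hx0, abs_zero, mul_zero]
      exact hη.le
  · have hx0 : R + 1 < |x 0| := by simpa [EuclideanSpace.inner_single_left] using hxR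
    rw [Pi.sub_apply, hgχ, hχ0 _ hx0, mul_zero, mul_zero, sub_zero]

theorem theorem3p1 (n : ℕ) (p : ℝ≥0∞) [Fact (1 ≤ p)] (hp : 2 ≤ p) (hp' : p < ∞)
    (φ : ℝ → ℝ)
    (hφ : IsUniversalApproximator φ p (Set.univ : Set ℝ)) :
    IsUniversalApproximator φ p (strip n) := by
  have hp1 : 1 < p := lt_of_lt_of_le (by norm_num) hp
  rw [isUniversalApproximator_iff, Measure.restrict_univ] at hφ
  rw [isUniversalApproximator_iff]
  intro f hf
  refine IsLpLimit.of_forall_exists hp1.le hf fun ε hε => ?_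
  obtain ⟨g, hgs, hfg, hg, -⟩ := hf.exists_hasCompactSupport_eLpNorm_sub_le hp'.ne hε
  exact ⟨g, isLpLimit_of_hasCompactSupport hp1 hp'.ne hφ hg hgs, hfg⟩
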